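/- All graphs are simple, non-empty and connected, and are identified with their vertex sets endowed with the graph metric $d$. A graph $X$ is \emph{coarsely $1$-connected} if there is some $R\ge 0$ such that filling in with discs all the cycles of $X$ of length at most $R$ produces a simply connected $2$-complex. It is \emph{uniformly one-ended} if for every $R\ge 0$ there is some $K\ge 0$ such that, for every $S\subset X$ of diameter at most $R$, exactly one connected component of $X\setminus S$ is unbounded and all the others have diameter at most $K$ (diameters are measured in $X$). For an integer $n\ge 2$, the \emph{lamplighter graph} $\mathcal{L}_n(X)$ is the graph whose vertices are the pairs $(c,x)$ with $c\in\mathbb{Z}_n^{(X)}$ a finitely supported map $X\to\mathbb{Z}_n=\mathbb{Z}/n\mathbb{Z}$ and $x\in X$; distinct vertices $(c_1,x_1)$ and $(c_2,x_2)$ are adjacent if either $c_1=c_2$ and $x_1,x_2$ are adjacent in $X$, or $x_1=x_2$ and $c_1,c_2$ differ only at this vertex. For $A>0$, $B\ge 0$, a map $f$ between two graphs $G,H$ is an \emph{$(A,B)$-quasi-isometry} if $\frac1A d(x,y)-B\le d(f(x),f(y))\le A\,d(x,y)+B$ for all $x,y\in G$ and every vertex of $H$ is at distance at most $B$ from $f(G)$;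 it is a \emph{quasi-isometry} if this holds for some $A,B$. A \emph{quasi-inverse} of $f$ is a quasi-isometry $g:H\to G$ such that $g\circ f$ and $f\circ g$ are at bounded distance from the identities. A map $q:\mathcal{L}_n(X)\to\mathcal{L}_m(Y)$ is \emph{of aptolic form} if there are maps $\alpha:\mathbb{Z}_n^{(X)}\to\mathbb{Z}_m^{(Y)}$ and $\beta:X\to Y$ such that $q(c,x)=(\alpha(c),\beta(x))$ for all $(c,x)$. An \emph{aptolic quasi-isometry} is a quasi-isometry of aptolic form that admits a quasi-inverse of aptolic form. \textbf{Theorem.} Let $n,m\ge 2$ be two integers and let $X,Y$ be two coarsely $1$-connected, uniformly one-ended graphs of bounded degree. For all $A>0$ and $B\ge 0$ there exists a constant $Q\ge 0$ (depending only on $n,m,X,Y,A,B$) such that for every $(A,B)$-quasi-isometry $q:\mathcal{L}_n(X)\to\mathcal{L}_m(Y)$ there is an aptolic quasi-isometry $q':\mathcal{L}_n(X)\to\mathcal{L}_m(Y)$ with $d(q(p),q'(p))\le Q$ for every vertex $p$ of $\mathcal{L}_n(X)$. In particular, every quasi-isometry $\mathcal{L}_n(X)\to\mathcal{L}_m(Y)$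 is at bounded distance from an aptolic quasi-isometry. -/

import Mathlib

/-- The lamplighter graph `𝓛ₙ(X)`: its vertices are the pairs `(c, x)`, where `c` is a finitely
supported `ℤ/n`-colouring of the vertices of `X` and `x` is a vertex of `X`; two pairs are adjacent
if the colourings agree and the arrows are adjacent in `X`, or if the arrows agree and the
colourings differ exactly at the vertex where the arrow is. -/
def lamplighterGraph {V : Type*} (n : ℕ) (X : SimpleGraph V) :
    SimpleGraph ((V →₀ ZMod n) × V) where
  Adj p q := (p.1 = q.1 ∧ X.Adj p.2 q.2) ∨
    (p.2 = q.2 ∧ p.1 ≠ q.1 ∧ ∀ y, y ≠ p.2 → p.1 y = q.1 y)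
  symm := ⟨by
    rintro p q (⟨h, ha⟩ | ⟨h, hne, hy⟩)
    · exact Or.inl ⟨h.symm, ha.symm⟩
    · exact Or.inr ⟨h.symm, hne.symm, fun y hyq => (hy y (by rwa [h])).symm⟩⟩
  loopless := ⟨by
    rintro p (⟨-, ha⟩ | ⟨-, hne, -⟩)
    · exact ha.ne rfl
    · exact hne rfl⟩

/-- `X` has bounded degree. -/
def HasBoundedDegree {V : Type*} (X : SimpleGraph V) : Prop :=
  ∃ D : ℕ, ∀ v : V, (X.neighborSet v).encard ≤ (D : ℕ∞)

/-- The subset `S` has diameter at most `R` for the graph metric of the (connected) graph `X`. -/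
def HasDiamLE {V : Type*} (X : SimpleGraph V) (S : Set V) (R : ℕ) : Prop :=
  ∀ x ∈ S, ∀ y ∈ S, X.dist x y ≤ R

/-- One move of a combinatorial homotopy in the 2-complex obtained from `X` by filling in with
discs the cycles of length at most `R`: the walk `p` is obtained from `q` by inserting, at some
vertex, a backtrack or a closed walk of length at most `R`. -/
def IsElementaryHomotopy {V : Type*} (X : SimpleGraph V) (R : ℕ) {u v : V} (p q : X.Walk u v) :
    Prop :=
  ∃ (w : V) (a : X.Walk u w) (c : X.Walk w w) (b : X.Walk w v),
    (c.length ≤ R ∨ ∃ (x : V) (h : X.Adj w x),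
      c = SimpleGraph.Walk.cons h (SimpleGraph.Walk.cons h.symm SimpleGraph.Walk.nil)) ∧
    p = (a.append c).append b ∧ q = a.append b

/-- `X` is coarsely 1-connected: it is connected and, for some `R`, filling in with discs the
cycles of length at most `R` produces a simply connected 2-complex, that is, every closed walk is
combinatorially homotopic to the trivial walk. -/
def IsCoarselyOneConnected {V : Type*} (X : SimpleGraph V) : Prop :=
  X.Connected ∧ ∃ R : ℕ, ∀ (v : V) (p : X.Walk v v),
    Relation.EqvGen (fun p q : X.Walk v v => IsElementaryHomotopy X R p q) p SimpleGraph.Walk.nil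

/-- `X` is uniformly one-ended: for every `R` there is `K` such that, for every set `A` of vertices
of diameter at most `R`, exactly one connected component of `X \ A` is unbounded, and all the
others have diameter at most `K` (all diameters being measured in `X`). -/
def IsUniformlyOneEnded {V : Type*} (X : SimpleGraph V) : Prop :=
  ∀ R : ℕ, ∃ K : ℕ, ∀ A : Set V, HasDiamLE X A R →
    ∃ C : (X.induce Aᶜ).ConnectedComponent,
      (∀ L : ℕ, ¬ HasDiamLE X (Subtype.val '' C.supp) L) ∧
      ∀ C' : (X.induce Aᶜ).ConnectedComponent, C' ≠ C →
        HasDiamLE X (Subtype.val '' C'.supp) K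

/-- `f` is an `(A, B)`-quasi-isometry between the vertex sets of the (connected) graphs `G` and
`H`, endowed with their graph metrics. -/
structure IsQuasiIsometryWith {V W : Type*} (G : SimpleGraph V) (H : SimpleGraph W) (A B : ℝ)
    (f : V → W) : Prop where
  pos : 0 < A
  nonneg : 0 ≤ B
  lower : ∀ x y : V, (1 / A) * (G.dist x y : ℝ) - B ≤ (H.dist (f x) (f y) : ℝ)
  upper : ∀ x y : V, (H.dist (f x) (f y) : ℝ) ≤ A * (G.dist x y : ℝ) + B
  coarselySurjective : ∀ z : W, ∃ x : V, (H.dist z (f x) : ℝ) ≤ B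

/-- `f` is a quasi-isometry. -/
def IsQuasiIsometry {V W : Type*} (G : SimpleGraph V) (H : SimpleGraph W) (f : V → W) : Prop :=
  ∃ A B : ℝ, IsQuasiIsometryWith G H A B f

/-- The two maps `f, g` with values in the vertex set of `H` are at distance at most `Q`. -/
def AreAtDistLE {V W : Type*} (H : SimpleGraph W) (Q : ℝ) (f g : V → W) : Prop :=
  ∀ x : V, (H.dist (f x) (g x) : ℝ) ≤ Q

/-- The quasi-isometry `g` is a quasi-inverse of `f`. -/
def IsQuasiInverse {V W : Type*} (G : SimpleGraph V) (H : SimpleGraph W) (f : V → W)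
    (g : W → V) : Prop :=
  IsQuasiIsometry H G g ∧ ∃ K : ℝ, AreAtDistLE G K (g ∘ f) id ∧ AreAtDistLE H K (f ∘ g) id

/-- The map `q : 𝓛ₙ(X) → 𝓛ₘ(Y)` is of aptolic form: `q (c, x) = (α c, β x)`. -/
def IsOfAptolicForm {V W : Type*} {n m : ℕ}
    (q : (V →₀ ZMod n) × V → (W →₀ ZMod m) × W) : Prop :=
  ∃ (α : (V →₀ ZMod n) → (W →₀ ZMod m)) (β : V → W), ∀ c x, q (c, x) = (α c, β x)

/-- The map `q : 𝓛ₙ(X) → 𝓛ₘ(Y)` is an aptolic quasi-isometry: it is a quasi-isometry of aptolic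
form that admits a quasi-inverse of aptolic form. -/
def IsAptolicQuasiIsometry {V W : Type*} (n m : ℕ) (X : SimpleGraph V) (Y : SimpleGraph W)
    (q : (V →₀ ZMod n) × V → (W →₀ ZMod m) × W) : Prop :=
  IsQuasiIsometry (lamplighterGraph n X) (lamplighterGraph m Y) q ∧ IsOfAptolicForm q ∧
    ∃ q' : (W →₀ ZMod m) × W → (V →₀ ZMod n) × V,
      IsQuasiInverse (lamplighterGraph n X) (lamplighterGraph m Y) q q' ∧ IsOfAptolicForm q'

/-! A leaf is the set of pairs with a given colouring. The theorem rests on two facts: leaves are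
coarsely preserved, and the induced map on arrows does not coarsely depend on the leaf.

Leaves (`exists_leaf`). Let `f` be a quasi-isometric embedding of `X` into the lamplighter graph
over `Y`, and fix a lamp `y`. The changes of colour of `y` along a walk are sorted according to the
colouring outside a large ball around `y`. This is a 1-cochain that vanishes on short cycles, so its
integral depends only on the endpoints, `X` being coarsely 1-connected. The component at a given
outer colouring lives on a bounded subset of `X`, and one-endedness lets a walk between two far
points avoid it. All components of the integral therefore vanish, and `y` has the same colour at all
points whose arrow is far from `y`. These colours form the leaf `α`.

Arrows (`LeafData.dist_le`). Write `β c x` for the arrow of `q (c, x)`. A quasi-inverse makes `α`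
injective. Switching the lamp at `x` changes `α c` only near `β c x`, and switchings at distant
vertices have disjoint effects. So modifying `c` far from `x` leaves unchanged the variation of `α`
due to `x`; it is nonzero and pins down `β c x`. The boundedly many lamps near `x` move `β c x` by a
bounded amount. Hence `q` is close to `(c, x) ↦ (α c, β 0 x)`. The same applied to a quasi-inverse
of `q` gives an aptolic quasi-inverse. -/

namespace Lamplighter

open SimpleGraph

/-! ### The metric of lamplighter graphs -/

section Metric

variable {V : Type*} {n : ℕ} {X : SimpleGraph V}

theorem exists_walk_moving (c : V →₀ ZMod n) {x y : V} (p : X.Walk x y) :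
    ∃ p' : (lamplighterGraph n X).Walk (c, x) (c, y), p'.length = p.length := by
  induction p with
  | nil => exact ⟨.nil, rfl⟩
  | @cons u v w h p ih =>
    obtain ⟨p', hp'⟩ := ih
    have hadj : (lamplighterGraph n X).Adj (c, u) (c, v) := Or.inl ⟨rfl, h⟩
    exact ⟨.cons hadj p', by simp [hp']⟩

theorem adj_of_eq_off {c c' : V →₀ ZMod n} {x : V} (hne : c ≠ c')
    (h : ∀ y, y ≠ x → c y = c' y) : (lamplighterGraph n X).Adj (c, x) (c', x) :=
  Or.inr ⟨rfl, hne, h⟩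

theorem dist_le_one_of_eq_off {c c' : V →₀ ZMod n} {x : V}
    (h : ∀ y, y ≠ x → c y = c' y) : (lamplighterGraph n X).dist (c, x) (c', x) ≤ 1 := by
  by_cases hne : c = c'
  · simp [hne]
  · exact (dist_eq_one_iff_adj.2 (adj_of_eq_off hne h)).le

theorem reachable_of_eq_off_finset (hX : X.Connected) (S : Finset V) (x : V) :
    ∀ c c' : V →₀ ZMod n, (∀ z, z ∉ S → c z = c' z) →
      (lamplighterGraph n X).Reachable (c, x) (c', x) := by
  classical
  induction S using Finset.induction_on with
  | empty =>
    intro c c' h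
    rw [Finsupp.ext fun z => h z (by simp)]
  | insert a S _ ih =>
    intro c c' h
    have move (d : V →₀ ZMod n) (u v : V) : (lamplighterGraph n X).Reachable (d, u) (d, v) :=
      ⟨(exists_walk_moving d (hX.preconnected u v).some).choose⟩
    refine (ih c (c'.update a (c a)) fun z hz => ?_).trans ?_
    · by_cases hza : z = a
      · simp [hza]
      · simpa [Function.update_of_ne hza] using h z (by simp [hz, hza])
    · refine (move _ x a).trans (Reachable.trans ?_ (move c' a x))
      by_cases he : c'.update a (c a) = c'
      · rw [he]
      · exact (adj_of_eq_off he fun z hz => by simp [Function.update_of_ne hz]).reachable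

theorem connected (hX : X.Connected) : (lamplighterGraph n X).Connected := by
  classical
  obtain ⟨x₀⟩ := hX.nonempty
  refine { preconnected := ?_, nonempty := ⟨(0, x₀)⟩ }
  rintro ⟨c, x⟩ ⟨c', x'⟩
  refine (reachable_of_eq_off_finset hX (c.support ∪ c'.support) x c c' fun z hz => ?_).trans
    ⟨(exists_walk_moving c' (hX.preconnected x x').some).choose⟩
  simp only [Finset.mem_union, Finsupp.mem_support_iff, not_or, not_not] at hz
  rw [hz.1, hz.2]

theorem dist_moving_le (hX : X.Connected) (c : V →₀ ZMod n) (x y : V) :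
    (lamplighterGraph n X).dist (c, x) (c, y) ≤ X.dist x y := by
  obtain ⟨p, hp⟩ := hX.exists_walk_length_eq_dist x y
  obtain ⟨p', hp'⟩ := exists_walk_moving c p
  rw [← hp, ← hp']
  exact dist_le p'

/-- A lamp changes only when the arrow stands at it, so a walk that recolours `z` passes through
`z`. -/
theorem walk_bounds (hX : X.Connected) {p q : (V →₀ ZMod n) × V}
    (w : (lamplighterGraph n X).Walk p q) :
    X.dist p.2 q.2 ≤ w.length ∧ ∀ z, p.1 z ≠ q.1 z → X.dist p.2 z ≤ w.length := by
  induction w with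
  | nil => simp
  | @cons p r q h w ih =>
    have h1 : X.dist p.2 r.2 ≤ 1 := by
      rcases h with ⟨-, h⟩ | ⟨h, -⟩
      · exact (dist_eq_one_iff_adj.2 h).le
      · simp [h]
    refine ⟨?_, fun z hz => ?_⟩
    · have := hX.dist_triangle (u := p.2) (v := r.2) (w := q.2)
      rw [Walk.length_cons]
      lia
    · rw [Walk.length_cons]
      by_cases hpr : p.1 z = r.1 z
      · have := hX.dist_triangle (u := p.2) (v := r.2) (w := z)
        have := ih.2 z (hpr ▸ hz)
        lia
      · rcases h with ⟨h, -⟩ | ⟨-, -, h⟩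
        · exact absurd (by rw [h]) hpr
        · have : z = p.2 := by
            by_contra hne
            exact hpr (h z hne)
          simp [this]

theorem dist_snd_le (hX : X.Connected) (p q : (V →₀ ZMod n) × V) :
    X.dist p.2 q.2 ≤ (lamplighterGraph n X).dist p q := by
  obtain ⟨w, hw⟩ := (connected (n := n) hX).exists_walk_length_eq_dist p q
  exact hw ▸ (walk_bounds hX w).1

theorem dist_le_of_ne (hX : X.Connected) {p q : (V →₀ ZMod n) × V} {z : V}
    (h : p.1 z ≠ q.1 z) : X.dist p.2 z ≤ (lamplighterGraph n X).dist p q := by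
  obtain ⟨w, hw⟩ := (connected (n := n) hX).exists_walk_length_eq_dist p q
  exact hw ▸ (walk_bounds hX w).2 z h

/-- Each lamp costs a return trip from `x`, at most `2 * r`, and one switch. -/
theorem dist_recolour_le (hX : X.Connected) (S : Finset V) (x : V) (r : ℕ)
    (hS : ∀ z ∈ S, X.dist x z ≤ r) : ∀ c c' : V →₀ ZMod n, (∀ z, z ∉ S → c z = c' z) →
      (lamplighterGraph n X).dist (c, x) (c', x) ≤ S.card * (2 * r + 1) := by
  classical
  induction S using Finset.induction_on with
  | empty =>
    intro c c' h
    rw [Finsupp.ext fun z => h z (by simp)]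
    simp
  | insert a S ha ih =>
    intro c c' h
    have hL := connected (n := n) hX
    have h1 := ih (fun z hz => hS z (Finset.mem_insert_of_mem hz)) c (c'.update a (c a))
      fun z hz => by
        by_cases hza : z = a
        · simp [hza]
        · simpa [Function.update_of_ne hza] using h z (by simp [hz, hza])
    have h2 := dist_moving_le hX (c'.update a (c a)) x a
    have h3 : (lamplighterGraph n X).dist (c'.update a (c a), a) (c', a) ≤ 1 :=
      dist_le_one_of_eq_off fun z hz => by simp [Function.update_of_ne hz]
    have h4 := dist_moving_le hX c' a x
    have h5 := hS a (Finset.mem_insert_self a S)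
    rw [X.dist_comm] at h4
    have t1 := hL.dist_triangle (u := (c, x)) (v := (c'.update a (c a), x)) (w := (c', x))
    have t2 := hL.dist_triangle (u := (c'.update a (c a), x)) (v := (c'.update a (c a), a))
      (w := (c', x))
    have t3 := hL.dist_triangle (u := (c'.update a (c a), a)) (v := (c', a)) (w := (c', x))
    rw [Finset.card_insert_of_notMem ha, add_mul]
    lia

/-- Balls of radius `r` have at most `b r` points, uniformly. -/
theorem exists_ball_bound (hX : X.Connected) (hdeg : HasBoundedDegree X) :
    ∃ b : ℕ → ℕ, ∀ r x, ∃ S : Finset V, S.card ≤ b r ∧ ∀ z, z ∈ S ↔ X.dist x z ≤ r := by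
  classical
  obtain ⟨D, hD⟩ := hdeg
  suffices h : ∀ r, ∃ N : ℕ, ∀ x, ∃ S : Finset V, S.card ≤ N ∧ ∀ z, z ∈ S ↔ X.dist x z ≤ r by
    choose b hb using h
    exact ⟨b, hb⟩
  intro r
  induction r with
  | zero =>
    refine ⟨1, fun x => ⟨{x}, by simp, fun z => ?_⟩⟩
    rw [Finset.mem_singleton, Nat.le_zero, hX.dist_eq_zero_iff, eq_comm]
  | succ r ih =>
    obtain ⟨N, hN⟩ := ih
    have hfin (v : V) : (X.neighborSet v).Finite :=
      Set.finite_of_encard_le_coe (hD v)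
    have hcard (v : V) : (hfin v).toFinset.card ≤ D := by
      have := hD v
      rw [(hfin v).encard_eq_coe_toFinset_card] at this
      exact_mod_cast this
    refine ⟨N + N * D, fun x => ?_⟩
    obtain ⟨S, hS, hmem⟩ := hN x
    refine ⟨S ∪ S.biUnion fun v => (hfin v).toFinset, ?_, fun z => ?_⟩
    · refine (Finset.card_union_le _ _).trans (add_le_add hS ?_)
      exact (Finset.card_biUnion_le_card_mul _ _ _ fun v _ => hcard v).trans
        (Nat.mul_le_mul_right _ hS)
    · simp only [Finset.mem_union, Finset.mem_biUnion, hmem, Set.Finite.mem_toFinset,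
        mem_neighborSet]
      constructor
      · rintro (h | ⟨v, hv, hvz⟩)
        · lia
        · have := hX.dist_triangle (u := x) (v := v) (w := z)
          rw [dist_eq_one_iff_adj.2 hvz] at this
          lia
      · intro h
        rcases Nat.lt_or_ge r (X.dist x z) with h' | h'
        · obtain ⟨p, hp⟩ := hX.exists_walk_length_eq_dist z x
          cases p with
          | nil => simp at h'
          | @cons _ v _ hadj p =>
            right
            refine ⟨v, ?_, hadj.symm⟩
            have := dist_le p
            rw [Walk.length_cons, X.dist_comm] at hp
            rw [X.dist_comm]
            lia
        · exact Or.inl h'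

theorem dist_le_of_eq_off_ball (hX : X.Connected) {b : ℕ → ℕ}
    (hb : ∀ r x, ∃ S : Finset V, S.card ≤ b r ∧ ∀ z, z ∈ S ↔ X.dist x z ≤ r)
    {c c' : V →₀ ZMod n} {x x' : V} {r : ℕ} (h : ∀ z, c z ≠ c' z → X.dist x z ≤ r) :
    (lamplighterGraph n X).dist (c, x) (c', x') ≤ b r * (2 * r + 1) + X.dist x x' := by
  obtain ⟨S, hS, hmem⟩ := hb r x
  have h1 := dist_recolour_le hX S x r (fun z hz => (hmem z).1 hz) c c' fun z hz => by
    by_contra hne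
    exact hz ((hmem z).2 (h z hne))
  have h2 := dist_moving_le hX c' x x'
  have h3 := (connected (n := n) hX).dist_triangle (u := (c, x)) (v := (c', x)) (w := (c', x'))
  have h4 := Nat.mul_le_mul_right (2 * r + 1) hS
  lia

end Metric

/-! ### Integration of 1-cochains along walks -/

section WalkIntegral

variable {V M : Type*} [AddCommGroup M] {X : SimpleGraph V}

/-- The integral along a walk of a function on pairs of vertices. -/
def walkIntegral (ω : V → V → M) : ∀ {u v : V}, X.Walk u v → M
  | _, _, .nil => 0
  | u, _, @Walk.cons _ _ _ v _ _ p => ω u v + walkIntegral ω p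

@[simp] theorem walkIntegral_nil (ω : V → V → M) (u : V) :
    walkIntegral ω (Walk.nil : X.Walk u u) = 0 := rfl

@[simp] theorem walkIntegral_cons (ω : V → V → M) {u v w : V} (h : X.Adj u v) (p : X.Walk v w) :
    walkIntegral ω (Walk.cons h p) = ω u v + walkIntegral ω p := rfl

theorem walkIntegral_append (ω : V → V → M) {u v w : V} (p : X.Walk u v) (q : X.Walk v w) :
    walkIntegral ω (p.append q) = walkIntegral ω p + walkIntegral ω q := by
  induction p with
  | nil => simp
  | cons h p ih => simp [ih, add_assoc]

theorem walkIntegral_reverse {ω : V → V → M} (hω : ∀ u v, X.Adj u v → ω v u = -ω u v) {u v : V}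
    (p : X.Walk u v) : walkIntegral ω p.reverse = -walkIntegral ω p := by
  induction p with
  | nil => simp
  | cons h p ih => simp [walkIntegral_append, ih, hω _ _ h]

theorem walkIntegral_eq_of_isElementaryHomotopy {ω : V → V → M}
    (hω : ∀ u v, X.Adj u v → ω v u = -ω u v) {R : ℕ}
    (hR : ∀ (w : V) (c : X.Walk w w), c.length ≤ R → walkIntegral ω c = 0) {u v : V}
    {p q : X.Walk u v} (h : IsElementaryHomotopy X R p q) :
    walkIntegral ω p = walkIntegral ω q := by
  obtain ⟨w, a, c, b, hc, rfl, rfl⟩ := h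
  have : walkIntegral ω c = 0 := by
    rcases hc with hc | ⟨x, h, rfl⟩
    · exact hR w c hc
    · simp [hω _ _ h]
  simp [walkIntegral_append, this]

/-- A discrete Poincaré lemma: antisymmetry kills backtracks and `hR` kills short cycles, so the
integral is invariant under the elementary homotopies that contract every closed walk. -/
theorem walkIntegral_eq_of_endpoints {ω : V → V → M}
    (hω : ∀ u v, X.Adj u v → ω v u = -ω u v) {R : ℕ}
    (hX : ∀ (v : V) (p : X.Walk v v),
      Relation.EqvGen (fun p q : X.Walk v v => IsElementaryHomotopy X R p q) p Walk.nil)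
    (hR : ∀ (w : V) (c : X.Walk w w), c.length ≤ R → walkIntegral ω c = 0) {u v : V}
    (p q : X.Walk u v) : walkIntegral ω p = walkIntegral ω q := by
  have closed (p : X.Walk u u) : walkIntegral ω p = 0 := by
    have key (p q : X.Walk u u)
        (h : Relation.EqvGen (fun p q : X.Walk u u => IsElementaryHomotopy X R p q) p q) :
        walkIntegral ω p = walkIntegral ω q := by
      induction h with
      | rel p q h => exact walkIntegral_eq_of_isElementaryHomotopy hω hR h
      | refl => rfl
      | symm _ _ _ ih => exact ih.symm
      | trans _ _ _ _ _ ih ih' => exact ih.trans ih'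
    exact key p .nil (hX u p)
  have := closed (p.append q.reverse)
  rw [walkIntegral_append, walkIntegral_reverse hω, ← sub_eq_add_neg] at this
  exact sub_eq_zero.1 this

theorem walkIntegral_eq_zero {ω : V → V → M} {u v : V} (p : X.Walk u v)
    (h : ∀ x ∈ p.support, ∀ y, X.Adj x y → ω x y = 0) : walkIntegral ω p = 0 := by
  induction p with
  | nil => rfl
  | cons hadj p ih =>
    rw [walkIntegral_cons, h _ (by simp) _ hadj, zero_add]
    exact ih fun x hx => h x (by simp [hx])

theorem walkIntegral_congr {ω ω' : V → V → M} {u v : V} (p : X.Walk u v)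
    (h : ∀ x ∈ p.support, ∀ y, ω x y = ω' x y) : walkIntegral ω p = walkIntegral ω' p := by
  induction p with
  | nil => rfl
  | cons hadj p ih =>
    rw [walkIntegral_cons, walkIntegral_cons, h _ (by simp)]
    exact congrArg _ (ih fun x hx => h x (by simp [hx]))

theorem walkIntegral_sub (g : V → M) {u v : V} (p : X.Walk u v) :
    walkIntegral (fun x y => g y - g x) p = g v - g u := by
  induction p with
  | nil => simp
  | cons hadj p ih => rw [walkIntegral_cons, ih]; abel

theorem map_walkIntegral {M' : Type*} [AddCommGroup M'] (F : M →+ M') (ω : V → V → M) {u v : V}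
    (p : X.Walk u v) : F (walkIntegral ω p) = walkIntegral (fun x y => F (ω x y)) p := by
  induction p with
  | nil => simp
  | cons hadj p ih => rw [walkIntegral_cons, walkIntegral_cons, map_add, ih]

end WalkIntegral

/-! ### Avoiding bounded sets in one-ended graphs -/

section OneEnded

variable {V : Type*} {X : SimpleGraph V}

/-- Otherwise the component of `x` stays within `K` of `x`, so neighbours of its points are within
`K + 1` and still outside `H`. The component would then be all of `X` and would meet `C`. -/
theorem reachable_of_forall_lt_dist (hX : X.Connected) {H : Set V} {K : ℕ}
    {C : (X.induce Hᶜ).ConnectedComponent}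
    (hC : ∀ C' : (X.induce Hᶜ).ConnectedComponent, C' ≠ C →
      HasDiamLE X (Subtype.val '' C'.supp) K) {x : V} (hx : ∀ h ∈ H, K + 1 < X.dist x h) :
    ∃ hxH : x ∈ Hᶜ, (X.induce Hᶜ).connectedComponentMk ⟨x, hxH⟩ = C := by
  have hxH : x ∈ Hᶜ := fun h => by simpa using hx x h
  refine ⟨hxH, ?_⟩
  by_contra hne
  have hdiam := hC _ hne
  have key (v : V) (p : X.Walk v x) : ∃ hv : v ∈ Hᶜ, (X.induce Hᶜ).Reachable ⟨v, hv⟩ ⟨x, hxH⟩ := by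
    induction p with
    | nil => exact ⟨hxH, .rfl⟩
    | @cons v v' x hadj p ih =>
      obtain ⟨hv', hr⟩ := ih hx hxH hne hdiam
      have hd : X.dist x v' ≤ K :=
        hdiam x ⟨⟨x, hxH⟩, rfl, rfl⟩ v' ⟨⟨v', hv'⟩, ConnectedComponent.sound hr, rfl⟩
      have hv : v ∈ Hᶜ := fun hv => by
        have := hx v hv
        have := hX.dist_triangle (u := x) (v := v') (w := v)
        rw [dist_eq_one_iff_adj.2 hadj.symm] at this
        lia
      have ha : (X.induce Hᶜ).Adj ⟨v, hv⟩ ⟨v', hv'⟩ := hadj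
      exact ⟨hv, ha.reachable.trans hr⟩
  obtain ⟨⟨u, hu⟩, rfl⟩ := C.exists_rep
  obtain ⟨_, hr⟩ := key u (hX.preconnected u x).some
  exact hne (ConnectedComponent.sound hr.symm)

/-- Far from a bounded set, any two vertices are joined by a walk avoiding it. -/
theorem exists_walk_avoiding (hX : X.Connected) (hX' : IsUniformlyOneEnded X) (D : ℕ) :
    ∃ K : ℕ, ∀ H : Set V, HasDiamLE X H D → ∀ x x' : V, (∀ h ∈ H, K < X.dist x h) →
      (∀ h ∈ H, K < X.dist x' h) → ∃ p : X.Walk x x', ∀ v ∈ p.support, v ∉ H := by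
  obtain ⟨K, hK⟩ := hX' D
  refine ⟨K + 1, fun H hH x x' hx hx' => ?_⟩
  obtain ⟨C, -, hC⟩ := hK H hH
  obtain ⟨h1, h2⟩ := reachable_of_forall_lt_dist hX hC hx
  obtain ⟨h1', h2'⟩ := reachable_of_forall_lt_dist hX hC hx'
  obtain ⟨p⟩ := ConnectedComponent.exact (h2.trans h2'.symm)
  refine ⟨p.map (Embedding.induce _).toHom, fun v hv => ?_⟩
  obtain ⟨⟨w, hw⟩, -, rfl⟩ := List.mem_map.1 ((Walk.support_map _ p) ▸ hv)
  exact hw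

end OneEnded

/-- `f` is a quasi-isometric embedding with integral constants `N`. -/
def IsQIEmbedding {V W : Type*} (N : ℕ) (G : SimpleGraph V) (H : SimpleGraph W) (f : V → W) :
    Prop :=
  ∀ x y, H.dist (f x) (f y) ≤ N * G.dist x y + N ∧ G.dist x y ≤ N * H.dist (f x) (f y) + N

/-! ### Embedding theorem: images of leaves are close to leaves -/

section Embedding

variable {V W : Type*} {m : ℕ} {X : SimpleGraph V} {Y : SimpleGraph W}

open Classical in
/-- The restriction of the colouring `c` to the complement of the ball `B(y, R)`. -/
noncomputable def restrictOff (Y : SimpleGraph W) (y : W) (R : ℕ) (c : W →₀ ZMod m) :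
    W → ZMod m :=
  fun z => if Y.dist y z ≤ R then 0 else c z

theorem restrictOff_eq_iff {y : W} {R : ℕ} {c c' : W →₀ ZMod m} :
    restrictOff Y y R c = restrictOff Y y R c' ↔ ∀ z, c z ≠ c' z → Y.dist y z ≤ R := by
  simp only [funext_iff, restrictOff]
  refine forall_congr' fun z => ?_
  split_ifs with h <;> simp [h]

/-- The variation of the colour of `y` along `f`, recorded together with the colouring away
from `y`. -/
noncomputable def colourCochain (Y : SimpleGraph W) (f : V → (W →₀ ZMod m) × W) (y : W) (R : ℕ)
    (u v : V) : (W → ZMod m) →₀ ZMod m :=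
  Finsupp.single (restrictOff Y y R (f u).1) ((f v).1 y - (f u).1 y)

variable {N : ℕ} {f : V → (W →₀ ZMod m) × W}

theorem near_of_ne (hY : Y.Connected) (hf : IsQIEmbedding N X (lamplighterGraph m Y) f) {u v : V}
    {z : W} (h : (f u).1 z ≠ (f v).1 z) : Y.dist (f u).2 z ≤ N * X.dist u v + N :=
  (dist_le_of_ne hY h).trans (hf u v).1

theorem near_of_adj (hY : Y.Connected) (hf : IsQIEmbedding N X (lamplighterGraph m Y) f) {u v : V}
    {z : W} (huv : X.Adj u v) (h : (f u).1 z ≠ (f v).1 z) : Y.dist (f u).2 z ≤ 2 * N := by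
  have := near_of_ne hY hf h
  rw [dist_eq_one_iff_adj.2 huv] at this
  lia

/-- If an edge changes the lamp at `y`, every lamp it changes is within `4 * N` of `y`, so both ends
have the same colouring off the ball. -/
theorem colourCochain_swap (hY : Y.Connected) (hf : IsQIEmbedding N X (lamplighterGraph m Y) f)
    {y : W} {R : ℕ} (hR : 4 * N ≤ R) {u v : V} (huv : X.Adj u v) :
    colourCochain Y f y R v u = -colourCochain Y f y R u v := by
  by_cases h : (f u).1 y = (f v).1 y
  · simp [colourCochain, h]
  · have h1 := near_of_adj hY hf huv h
    have h2 : restrictOff Y y R (f u).1 = restrictOff Y y R (f v).1 :=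
      restrictOff_eq_iff.2 fun z hz => by
        have h3 := near_of_adj hY hf huv hz
        have h4 := hY.dist_triangle (u := y) (v := (f u).2) (w := z)
        rw [Y.dist_comm] at h1
        lia
    rw [colourCochain, colourCochain, h2, ← Finsupp.single_neg, neg_sub]

/-- If the short cycle comes near `y`, all its lamp changes stay in the ball, so the outer colouring
is constant and the cochain is the differential of the colour of `y`. If not, the lamp at `y` never
changes. -/
theorem walkIntegral_colourCochain_closed (hX : X.Connected) (hY : Y.Connected)
    (hf : IsQIEmbedding N X (lamplighterGraph m Y) f) {y : W} {R R₀ : ℕ}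
    (hR : N * (2 * R₀) + N + 2 * N ≤ R) {w : V} (c : X.Walk w w) (hc : c.length ≤ R₀) :
    walkIntegral (colourCochain Y f y R) c = 0 := by
  classical
  by_cases hnear : ∃ x ∈ c.support, Y.dist (f x).2 y ≤ 2 * N
  · obtain ⟨x, hx, hxy⟩ := hnear
    have hbase (v : V) (hv : v ∈ c.support) : X.dist w v ≤ R₀ :=
      (dist_le (c.takeUntil v hv)).trans ((c.length_takeUntil_le_length hv).trans hc)
    have hrest (v : V) (hv : v ∈ c.support) :
        restrictOff Y y R (f v).1 = restrictOff Y y R (f x).1 :=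
      (restrictOff_eq_iff.2 fun z hz => by
        have h1 := near_of_ne hY hf hz
        have h2 := hX.dist_triangle (u := x) (v := w) (w := v)
        have h3 := hbase v hv
        have h4 := hbase x hx
        rw [X.dist_comm] at h4
        have h5 := hY.dist_triangle (u := y) (v := (f x).2) (w := z)
        rw [Y.dist_comm] at hxy
        have h6 : N * X.dist x v ≤ N * (2 * R₀) := Nat.mul_le_mul_left _ (by lia)
        lia).symm
    have h1 : walkIntegral (colourCochain Y f y R) c =
        walkIntegral (fun u v => Finsupp.singleAddHom (restrictOff Y y R (f x).1)
          ((f v).1 y - (f u).1 y)) c :=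
      walkIntegral_congr c fun u hu v => by
        rw [colourCochain, hrest u hu, Finsupp.singleAddHom_apply]
    rw [h1, ← map_walkIntegral, walkIntegral_sub (fun v => (f v).1 y), sub_self, map_zero]
  · push Not at hnear
    refine walkIntegral_eq_zero c fun u hu v huv => ?_
    have : (f u).1 y = (f v).1 y := by
      by_contra hne
      exact (hnear u hu).not_ge (near_of_adj hY hf huv hne)
    simp [colourCochain, this]

/-- The part of `X` where `f` may switch the lamp at `y` while the lamps away from `y` are
given by `e`. -/
def switchSet (Y : SimpleGraph W) (f : V → (W →₀ ZMod m) × W) (y : W) (N R : ℕ) (e : W → ZMod m) :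
    Set V :=
  {x | Y.dist (f x).2 y ≤ 2 * N ∧ restrictOff Y y R (f x).1 = e}

/-- The images of two points of the set have arrows at most `4 * N` apart and colourings that differ
only in a ball of bounded size. -/
theorem hasDiamLE_switchSet (hY : Y.Connected) {b : ℕ → ℕ}
    (hb : ∀ r x, ∃ S : Finset W, S.card ≤ b r ∧ ∀ z, z ∈ S ↔ Y.dist x z ≤ r)
    (hf : IsQIEmbedding N X (lamplighterGraph m Y) f) (y : W) (R : ℕ) (e : W → ZMod m) :
    HasDiamLE X (switchSet Y f y N R e)
      (N * (b (2 * N + R) * (2 * (2 * N + R) + 1) + 4 * N) + N) := by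
  rintro x ⟨hx, hxe⟩ x' ⟨hx', hxe'⟩
  have h1 := dist_le_of_eq_off_ball hY hb (c := (f x).1) (c' := (f x').1) (x := (f x).2)
    (x' := (f x').2) (r := 2 * N + R) fun z hz => by
      have := restrictOff_eq_iff.1 (hxe.trans hxe'.symm) z hz
      have := hY.dist_triangle (u := (f x).2) (v := y) (w := z)
      lia
  have h2 := hY.dist_triangle (u := (f x).2) (v := y) (w := (f x').2)
  rw [Y.dist_comm (u := y)] at h2
  refine (hf x x').2.trans (Nat.add_le_add_right (Nat.mul_le_mul_left _ ?_) _)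
  exact h1.trans (by lia)

/-- **Embedding theorem**: quasi-isometric embeddings of coarsely 1-connected uniformly one-ended
graphs into lamplighter graphs have their images close to a leaf. -/
theorem exists_leaf (hX : IsCoarselyOneConnected X) (hX' : IsUniformlyOneEnded X)
    (hY : Y.Connected) (hYdeg : HasBoundedDegree Y) (N : ℕ) :
    ∃ M : ℕ, ∀ f : V → (W →₀ ZMod m) × W, IsQIEmbedding N X (lamplighterGraph m Y) f →
      ∃ α : W →₀ ZMod m, ∀ x y, (f x).1 y ≠ α y → Y.dist (f x).2 y ≤ M := by
  classical
  obtain ⟨hXc, R₀, hR₀⟩ := hX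
  obtain ⟨b, hb⟩ := exists_ball_bound hY hYdeg
  -- Large enough both for vanishing on short cycles and for antisymmetry.
  obtain ⟨R, hR⟩ : ∃ R, N * (2 * R₀) + N + 2 * N + 4 * N = R := ⟨_, rfl⟩
  obtain ⟨K, hK⟩ := exists_walk_avoiding hXc hX'
    (N * (b (2 * N + R) * (2 * (2 * N + R) + 1) + 4 * N) + N)
  refine ⟨N * K + N + 2 * N, fun f hf => ?_⟩
  have key (y : W) (x x' : V) (hx : N * K + N + 2 * N < Y.dist (f x).2 y)
      (hx' : N * K + N + 2 * N < Y.dist (f x').2 y) : (f x).1 y = (f x').1 y := by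
    have hfar (e : W → ZMod m) (x : V) (hx : N * K + N + 2 * N < Y.dist (f x).2 y) (h : V)
        (hh : h ∈ switchSet Y f y N R e) : K < X.dist x h := by
      by_contra! hle
      have h1 := (dist_snd_le hY (f x) (f h)).trans (hf x h).1
      have h2 := hY.dist_triangle (u := (f x).2) (v := (f h).2) (w := y)
      have h3 := Nat.mul_le_mul_left N hle
      have h4 := hh.1
      lia
    obtain ⟨p⟩ := hXc.preconnected x x'
    have hzero : walkIntegral (colourCochain Y f y R) p = 0 := by
      ext e
      -- The avoiding walk depends on `e`; this is harmless, as the integral over `p` equals that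
      -- over any such `p'`.
      obtain ⟨p', hp'⟩ := hK _ (hasDiamLE_switchSet hY hb hf y R e) x x' (hfar e x hx)
        (hfar e x' hx')
      rw [walkIntegral_eq_of_endpoints
        (fun u v huv => colourCochain_swap hY hf (by lia) huv) hR₀
        (fun w c hc => walkIntegral_colourCochain_closed hXc hY hf (by lia) c hc) p p']
      change Finsupp.applyAddHom e _ = _
      rw [map_walkIntegral]
      refine walkIntegral_eq_zero p' fun u hu v huv => ?_
      have hu' := hp' u hu
      rw [Finsupp.applyAddHom_apply, colourCochain, Finsupp.single_apply]
      split_ifs with he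
      · by_contra hne
        exact hu' ⟨near_of_adj hY hf huv fun h => hne (by rw [h, sub_self]), he⟩
      · rfl
    -- Adding up the components over all outer colourings recovers the total change of the colour of
    -- `y`.
    have hsum := congrArg (Finsupp.liftAddHom fun _ : W → ZMod m => AddMonoidHom.id (ZMod m)) hzero
    rw [map_walkIntegral, map_zero] at hsum
    simp only [colourCochain, Finsupp.liftAddHom_apply_single, AddMonoidHom.id_apply] at hsum
    rw [walkIntegral_sub (fun v => (f v).1 y)] at hsum
    exact (sub_eq_zero.1 hsum).symm
  obtain ⟨x₀⟩ := hXc.nonempty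
  have hval (y : W) : ∃ a : ZMod m, ∀ x, (f x).1 y ≠ a → Y.dist (f x).2 y ≤ N * K + N + 2 * N := by
    by_cases hfar : ∃ x, N * K + N + 2 * N < Y.dist (f x).2 y
    · obtain ⟨x, hx⟩ := hfar
      exact ⟨(f x).1 y, fun x' hne => le_of_not_gt fun hx' => hne (key y x' x hx' hx)⟩
    · push Not at hfar
      -- No arrow is far from `y`: any colour would do.
      exact ⟨0, fun x _ => hfar x⟩
  choose α hα using hval
  -- Finite support: `α` agrees with the colouring of the single point `f x₀` outside a ball.
  obtain ⟨S, -, hS⟩ := hb (N * K + N + 2 * N) (f x₀).2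
  refine ⟨Finsupp.onFinset (S ∪ (f x₀).1.support) α fun y hy => ?_, fun x y h => hα y x h⟩
  by_contra hmem
  simp only [Finset.mem_union, not_or, Finsupp.mem_support_iff, not_not] at hmem
  exact hmem.1 ((hS y).2 (hα y x₀ (by rw [hmem.2]; exact hy.symm)))

end Embedding

/-! ### The map induced on leaves -/

section LeafPreserving

variable {V W : Type*} {n m : ℕ} {X : SimpleGraph V} {Y : SimpleGraph W}

theorem isQIEmbedding_leaf (hX : X.Connected) {N : ℕ}
    {q : (V →₀ ZMod n) × V → (W →₀ ZMod m) × W}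
    (hq : IsQIEmbedding N (lamplighterGraph n X) (lamplighterGraph m Y) q) (c : V →₀ ZMod n) :
    IsQIEmbedding N X (lamplighterGraph m Y) fun x => q (c, x) := by
  intro x x'
  have h : (lamplighterGraph n X).dist (c, x) (c, x') = X.dist x x' :=
    (dist_moving_le hX c x x').antisymm (dist_snd_le hX (c, x) (c, x'))
  rw [← h]
  exact hq _ _

/-- `q` maps the leaf of colour `c` close to the leaf of colour `α c`. -/
def MapsLeavesNear (Y : SimpleGraph W) (M : ℕ) (q : (V →₀ ZMod n) × V → (W →₀ ZMod m) × W)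
    (α : (V →₀ ZMod n) → W →₀ ZMod m) : Prop :=
  ∀ c x y, (q (c, x)).1 y ≠ α c y → Y.dist (q (c, x)).2 y ≤ M

theorem exists_mapsLeavesNear (hX : IsCoarselyOneConnected X) (hX' : IsUniformlyOneEnded X)
    (hY : Y.Connected) (hYdeg : HasBoundedDegree Y) (n m N : ℕ) :
    ∃ M : ℕ, ∀ q : (V →₀ ZMod n) × V → (W →₀ ZMod m) × W,
      IsQIEmbedding N (lamplighterGraph n X) (lamplighterGraph m Y) q →
        ∃ α, MapsLeavesNear Y M q α := by
  obtain ⟨M, hM⟩ := exists_leaf (m := m) hX hX' hY hYdeg N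
  refine ⟨M, fun q hq => ?_⟩
  choose α hα using fun c => hM _ (isQIEmbedding_leaf hX.1 hq c)
  exact ⟨α, hα⟩

theorem exists_lt_dist (hX : X.Connected) (hX' : IsUniformlyOneEnded X) (v : V) (L : ℕ) :
    ∃ x, L < X.dist v x := by
  by_contra! h
  obtain ⟨K, hK⟩ := hX' 0
  obtain ⟨C, hC, -⟩ := hK ∅ (by simp [HasDiamLE])
  refine hC (2 * L) fun x _ y _ => ?_
  have h1 := hX.dist_triangle (u := x) (v := v) (w := y)
  have h2 := h x
  rw [X.dist_comm] at h2
  have h3 := h y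
  lia

/-- A map that is close to the identity of the leaf `c` and sends it close to the leaf `c'`
forces `c = c'`. -/
theorem eq_of_leaves_near (hX : X.Connected) (hX' : IsUniformlyOneEnded X)
    {c c' : V →₀ ZMod n} {T : ℕ} (u : V → V)
    (h : ∀ x, (lamplighterGraph n X).dist (c, x) (c', u x) ≤ T) : c = c' := by
  ext z
  by_contra hne
  obtain ⟨x, hx⟩ := exists_lt_dist hX hX' z T
  have := (dist_le_of_ne hX (p := (c, x)) (q := (c', u x)) hne).trans (h x)
  rw [X.dist_comm] at this
  lia

theorem MapsLeavesNear.dist_le {b : ℕ → ℕ} (hY : Y.Connected)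
    (hb : ∀ r x, ∃ S : Finset W, S.card ≤ b r ∧ ∀ z, z ∈ S ↔ Y.dist x z ≤ r) {M : ℕ}
    {q : (V →₀ ZMod n) × V → (W →₀ ZMod m) × W} {α : (V →₀ ZMod n) → W →₀ ZMod m}
    (hα : MapsLeavesNear Y M q α) (c : V →₀ ZMod n) (x : V) :
    (lamplighterGraph m Y).dist (q (c, x)) (α c, (q (c, x)).2) ≤ b M * (2 * M + 1) := by
  have := dist_le_of_eq_off_ball hY hb (x' := (q (c, x)).2) fun z => hα c x z
  simpa using this

/-- Following `q` by `p` brings the leaf `c` near the leaf `α' (α c)` and moves points boundedly, so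
`α' (α c) = c`. -/
theorem MapsLeavesNear.injective (hX : X.Connected) (hX' : IsUniformlyOneEnded X)
    (hY : Y.Connected) {N M M' : ℕ} {q : (V →₀ ZMod n) × V → (W →₀ ZMod m) × W}
    {p : (W →₀ ZMod m) × W → (V →₀ ZMod n) × V} {b b' : ℕ → ℕ}
    (hb : ∀ r x, ∃ S : Finset W, S.card ≤ b r ∧ ∀ z, z ∈ S ↔ Y.dist x z ≤ r)
    (hb' : ∀ r x, ∃ S : Finset V, S.card ≤ b' r ∧ ∀ z, z ∈ S ↔ X.dist x z ≤ r)
    (hp : IsQIEmbedding N (lamplighterGraph m Y) (lamplighterGraph n X) p)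
    (hpq : ∀ x, (lamplighterGraph n X).dist (p (q x)) x ≤ N)
    {α : (V →₀ ZMod n) → W →₀ ZMod m} (hα : MapsLeavesNear Y M q α)
    {α' : (W →₀ ZMod m) → V →₀ ZMod n} (hα' : MapsLeavesNear X M' p α') :
    Function.Injective α := by
  have hleft : Function.LeftInverse α' α := fun c => by
    refine (eq_of_leaves_near hX hX' (fun x => (p (α c, (q (c, x)).2)).2)
      (T := N + (N * (b M * (2 * M + 1)) + N) + b' M' * (2 * M' + 1)) fun x => ?_).symm
    have hL := connected (n := n) hX
    have h1 := hpq (c, x)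
    have h2 := (hp (q (c, x)) (α c, (q (c, x)).2)).1
    have h3 := Nat.mul_le_mul_left N (hα.dist_le hY hb c x)
    have h4 := hα'.dist_le hX hb' (α c) (q (c, x)).2
    rw [SimpleGraph.dist_comm] at h1
    have t1 := hL.dist_triangle (u := (c, x)) (v := p (q (c, x))) (w := p (α c, (q (c, x)).2))
    have t2 := hL.dist_triangle (u := (c, x)) (v := p (α c, (q (c, x)).2))
      (w := (α' (α c), (p (α c, (q (c, x)).2)).2))
    lia
  exact hleft.injective

/-- The data shared by the comparison of two leaves: the constants depend only on the graphs and
on the quasi-isometry constants. -/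
structure LeafData (X : SimpleGraph V) (Y : SimpleGraph W) (N C ρ : ℕ)
    (α : (V →₀ ZMod n) → W →₀ ZMod m) (β : (V →₀ ZMod n) → V → W) : Prop where
  injective : Function.Injective α
  dist_switch : ∀ c a x, Y.dist (β c x) (β (c + Finsupp.single x a) x) ≤ C
  near_of_ne : ∀ c a x y, α c y ≠ α (c + Finsupp.single x a) y → Y.dist (β c x) y ≤ C
  upper : ∀ c x x', Y.dist (β c x) (β c x') ≤ N * X.dist x x' + N
  lower : ∀ c x x', Y.dist (β c x) (β c x') ≤ 4 * C → X.dist x x' ≤ ρ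

/-! ### Coarse independence of the arrow from the colouring -/

namespace LeafData

variable {N C ρ : ℕ} {α : (V →₀ ZMod n) → W →₀ ZMod m} {β : (V →₀ ZMod n) → V → W}

/-- The claim is that a second difference, symmetric in the switches at `p` and `x`, vanishes. At a
lamp `y` where it did not, `y` would be close to the images of both `p` and `x`, which are far
apart. -/
theorem variation_add_single (h : LeafData X Y N C ρ α β) (hY : Y.Connected) {x p : V}
    (hp : ρ < X.dist p x) (a e : ZMod n) (c : V →₀ ZMod n) :
    α (c + Finsupp.single p a + Finsupp.single x e) - α (c + Finsupp.single p a) =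
      α (c + Finsupp.single x e) - α c := by
  have hcomm : c + Finsupp.single p a + Finsupp.single x e =
      c + Finsupp.single x e + Finsupp.single p a := add_right_comm _ _ _
  have far (c : V →₀ ZMod n) (z : W) (hz : Y.dist (β c p) z ≤ 2 * C)
      (hw : Y.dist (β c x) z ≤ 2 * C) : False := by
    refine hp.not_ge (h.lower c p x ?_)
    have := hY.dist_triangle (u := β c p) (v := z) (w := β c x)
    rw [Y.dist_comm (u := z)] at this
    lia
  have moved (c : V →₀ ZMod n) (a : ZMod n) (x : V) (z : W) (hz : Y.dist (β c x) z ≤ C) :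
      Y.dist (β (c + Finsupp.single x a) x) z ≤ 2 * C := by
    have h1 := h.dist_switch c a x
    have h2 := hY.dist_triangle (u := β (c + Finsupp.single x a) x) (v := β c x) (w := z)
    rw [Y.dist_comm] at h1
    lia
  ext y
  simp only [Finsupp.sub_apply]
  by_contra hne
  have hpy : Y.dist (β c p) y ≤ C ∨ Y.dist (β (c + Finsupp.single x e) p) y ≤ C := by
    by_contra! hcon
    have h1 : α c y = α (c + Finsupp.single p a) y := by
      by_contra h'
      exact hcon.1.not_ge (h.near_of_ne _ _ _ _ h')
    have h2 : α (c + Finsupp.single x e) y = α (c + Finsupp.single x e + Finsupp.single p a) y := by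
      by_contra h'
      exact hcon.2.not_ge (h.near_of_ne _ _ _ _ h')
    exact hne (by rw [hcomm, ← h1, ← h2])
  have hxy : Y.dist (β c x) y ≤ C ∨ Y.dist (β (c + Finsupp.single p a) x) y ≤ C := by
    by_contra! hcon
    have h1 : α c y = α (c + Finsupp.single x e) y := by
      by_contra h'
      exact hcon.1.not_ge (h.near_of_ne _ _ _ _ h')
    have h2 : α (c + Finsupp.single p a) y = α (c + Finsupp.single p a + Finsupp.single x e) y := by
      by_contra h'
      exact hcon.2.not_ge (h.near_of_ne _ _ _ _ h')
    exact hne (by rw [← h1, ← h2, sub_self, sub_self])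
  -- In each case one colouring puts `y` within `2 * C` of both images, `moved` paying the extra
  -- `C`.
  rcases hpy with hpy | hpy <;> rcases hxy with hxy | hxy
  · exact far c y (by lia) (by lia)
  · exact far (c + Finsupp.single p a) y (moved _ _ _ _ hpy) (by lia)
  · exact far (c + Finsupp.single x e) y (by lia) (moved _ _ _ _ hxy)
  · refine far (c + Finsupp.single p a + Finsupp.single x e) y ?_ (moved _ _ _ _ hxy)
    rw [hcomm]
    exact moved _ _ _ _ hpy

theorem variation_add (h : LeafData X Y N C ρ α β) (hY : Y.Connected) {x : V} (e : ZMod n)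
    (f : V →₀ ZMod n) : (∀ p ∈ f.support, ρ < X.dist p x) → ∀ c : V →₀ ZMod n,
      α (c + f + Finsupp.single x e) - α (c + f) = α (c + Finsupp.single x e) - α c := by
  classical
  induction f using Finsupp.induction with
  | zero => simp
  | single_add a b f ha hb ih =>
    intro hf c
    rw [Finsupp.support_single_add ha hb] at hf
    rw [add_comm _ f, ← add_assoc, h.variation_add_single hY (hf a (by simp)),
      ih fun p hp => hf p (by simp [hp])]

/-- By injectivity the switch at `x` changes some lamp `y` of `α c`; it changes the same lamp of `α
(c + f)`, so `y` is within `C` of both arrows. -/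
theorem dist_far_le (h : LeafData X Y N C ρ α β) (hY : Y.Connected) (hn : 2 ≤ n) {x : V}
    {f : V →₀ ZMod n} (hf : ∀ p ∈ f.support, ρ < X.dist p x) (c : V →₀ ZMod n) :
    Y.dist (β c x) (β (c + f) x) ≤ 2 * C := by
  have : Fact (1 < n) := ⟨hn⟩
  have hne : α (c + Finsupp.single x 1) - α c ≠ 0 := fun h0 => by
    have := h.injective (sub_eq_zero.1 h0)
    simp at this
  obtain ⟨y, hy⟩ := Finsupp.ne_iff.1 hne
  have hy' := hy
  rw [← h.variation_add hY 1 f hf] at hy'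
  have h1 := h.near_of_ne c 1 x y fun h' => hy (by simp [h'])
  have h2 := h.near_of_ne (c + f) 1 x y fun h' => hy' (by simp [h'])
  have := hY.dist_triangle (u := β c x) (v := y) (w := β (c + f) x)
  rw [Y.dist_comm (u := y)] at this
  lia

/-- For each lamp `a`: go from `x` to `a` in one leaf, switch at `a`, and return in the new leaf. -/
theorem dist_near_le (h : LeafData X Y N C ρ α β) (hY : Y.Connected) {x : V}
    (f : V →₀ ZMod n) : (∀ p ∈ f.support, X.dist p x ≤ ρ) → ∀ c : V →₀ ZMod n,
      Y.dist (β c x) (β (c + f) x) ≤ f.support.card * (2 * (N * ρ + N) + C) := by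
  classical
  induction f using Finsupp.induction with
  | zero => simp
  | single_add a b f ha hb ih =>
    intro hf c
    rw [Finsupp.support_single_add ha hb] at hf ⊢
    rw [Finset.card_cons, add_mul, one_mul, add_comm _ f, ← add_assoc]
    have h0 := Nat.mul_le_mul_left N (hf a (by simp))
    have h1 := ih (fun p hp => hf p (by simp [hp])) c
    have h2 := h.upper (c + f) a x
    have h3 := h.dist_switch (c + f) b a
    have h4 := h.upper (c + f + Finsupp.single a b) a x
    rw [Y.dist_comm] at h2
    have t1 := hY.dist_triangle (u := β c x) (v := β (c + f) x)
      (w := β (c + f + Finsupp.single a b) x)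
    have t2 := hY.dist_triangle (u := β (c + f) x) (v := β (c + f) a)
      (w := β (c + f + Finsupp.single a b) x)
    have t3 := hY.dist_triangle (u := β (c + f) a) (v := β (c + f + Finsupp.single a b) a)
      (w := β (c + f + Finsupp.single a b) x)
    lia

theorem dist_le (h : LeafData X Y N C ρ α β) (hY : Y.Connected) (hn : 2 ≤ n) {b : ℕ → ℕ}
    (hb : ∀ r x, ∃ S : Finset V, S.card ≤ b r ∧ ∀ z, z ∈ S ↔ X.dist x z ≤ r)
    (c : V →₀ ZMod n) (x : V) :
    Y.dist (β c x) (β 0 x) ≤ b ρ * (2 * (N * ρ + N) + C) + 2 * C := by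
  classical
  obtain ⟨S, hS, hmem⟩ := hb ρ x
  have hdec := Finsupp.filter_add_filter_not c (· ∈ S)
  have h1 := h.dist_near_le hY (x := x) (c.filter (· ∈ S)) (fun p hp => by
    rw [Finsupp.support_filter, Finset.mem_filter] at hp
    rw [X.dist_comm]
    exact (hmem p).1 hp.2) 0
  have h2 := h.dist_far_le hY hn (x := x) (f := c.filter (¬ · ∈ S)) (fun p hp => by
    rw [Finsupp.support_filter, Finset.mem_filter, hmem, not_le, X.dist_comm] at hp
    exact hp.2) (c.filter (· ∈ S))
  rw [hdec] at h2
  rw [zero_add] at h1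
  have hcard : (c.filter (· ∈ S)).support.card ≤ b ρ :=
    (Finset.card_le_card fun p hp => by
      rw [Finsupp.support_filter, Finset.mem_filter] at hp
      exact hp.2).trans hS
  have h3 := Nat.mul_le_mul_right (2 * (N * ρ + N) + C) hcard
  have t := hY.dist_triangle (u := β 0 x) (v := β (c.filter (· ∈ S)) x) (w := β c x)
  rw [Y.dist_comm]
  lia

end LeafData

/-- A switch moves the image by at most `2 * N`, and `M` is the error between the image and its
leaf. The last constant adds the cost of projecting two points to the leaf. -/
theorem MapsLeavesNear.leafData (hX : X.Connected) (hY : Y.Connected) {N M : ℕ} {b : ℕ → ℕ}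
    (hb : ∀ r x, ∃ S : Finset W, S.card ≤ b r ∧ ∀ z, z ∈ S ↔ Y.dist x z ≤ r)
    {q : (V →₀ ZMod n) × V → (W →₀ ZMod m) × W}
    (hq : IsQIEmbedding N (lamplighterGraph n X) (lamplighterGraph m Y) q)
    {α : (V →₀ ZMod n) → W →₀ ZMod m} (hα : MapsLeavesNear Y M q α)
    (hinj : Function.Injective α) :
    LeafData X Y N (M + 2 * N)
      (N * (2 * (b M * (2 * M + 1)) + 4 * (M + 2 * N)) + N) α fun c x => (q (c, x)).2 := by
  have step (c : V →₀ ZMod n) (a : ZMod n) (x : V) :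
      (lamplighterGraph m Y).dist (q (c, x)) (q (c + Finsupp.single x a, x)) ≤ 2 * N := by
    have h1 := (hq (c, x) (c + Finsupp.single x a, x)).1
    have h2 : (lamplighterGraph n X).dist (c, x) (c + Finsupp.single x a, x) ≤ 1 :=
      dist_le_one_of_eq_off fun y hy => by simp [Finsupp.single_eq_of_ne hy]
    have h3 := Nat.mul_le_mul_left N h2
    lia
  refine ⟨hinj, fun c a x => ?_, fun c a x y hne => ?_, fun c x x' => ?_, fun c x x' h => ?_⟩
  · exact (dist_snd_le hY _ _).trans ((step c a x).trans (by lia))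
  · have h0 := (dist_snd_le hY _ _).trans (step c a x)
    by_cases h1 : (q (c, x)).1 y = α c y
    · by_cases h2 : (q (c + Finsupp.single x a, x)).1 y = α (c + Finsupp.single x a) y
      · have := (dist_le_of_ne hY (fun h => hne (h1.symm.trans (h.trans h2)))).trans (step c a x)
        exact this.trans (by lia)
      · have h3 := hα _ _ _ h2
        have := hY.dist_triangle (u := (q (c, x)).2) (v := (q (c + Finsupp.single x a, x)).2)
          (w := y)
        lia
    · exact (hα _ _ _ h1).trans (by lia)
  · exact (dist_snd_le hY _ _).trans (isQIEmbedding_leaf hX hq c x x').1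
  · refine (isQIEmbedding_leaf hX hq c x x').2.trans
      (Nat.add_le_add_right (Nat.mul_le_mul_left N ?_) N)
    have hL := connected (n := m) hY
    have h1 := hα.dist_le hY hb c x
    have h2 := hα.dist_le hY hb c x'
    have h3 := dist_moving_le hY (α c) (q (c, x)).2 (q (c, x')).2
    rw [SimpleGraph.dist_comm] at h2
    have t1 := hL.dist_triangle (u := q (c, x)) (v := (α c, (q (c, x)).2)) (w := q (c, x'))
    have t2 := hL.dist_triangle (u := (α c, (q (c, x)).2)) (v := (α c, (q (c, x')).2))
      (w := q (c, x'))
    change (lamplighterGraph m Y).dist (q (c, x)) (q (c, x')) ≤ _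
    lia

/-- Quasi-isometries between lamplighter graphs are uniformly close to maps of aptolic form. -/
theorem exists_aptolicForm_near (hn : 2 ≤ n)
    (hX : IsCoarselyOneConnected X) (hX' : IsUniformlyOneEnded X) (hXdeg : HasBoundedDegree X)
    (hY : IsCoarselyOneConnected Y) (hY' : IsUniformlyOneEnded Y) (hYdeg : HasBoundedDegree Y)
    (N : ℕ) : ∃ Q : ℕ, ∀ (q : (V →₀ ZMod n) × V → (W →₀ ZMod m) × W)
      (p : (W →₀ ZMod m) × W → (V →₀ ZMod n) × V),
      IsQIEmbedding N (lamplighterGraph n X) (lamplighterGraph m Y) q →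
      IsQIEmbedding N (lamplighterGraph m Y) (lamplighterGraph n X) p →
      (∀ x, (lamplighterGraph n X).dist (p (q x)) x ≤ N) →
      ∃ q', IsOfAptolicForm q' ∧ ∀ x, (lamplighterGraph m Y).dist (q x) (q' x) ≤ Q := by
  obtain ⟨b, hb⟩ := exists_ball_bound hY.1 hYdeg
  obtain ⟨b', hb'⟩ := exists_ball_bound hX.1 hXdeg
  obtain ⟨M, hM⟩ := exists_mapsLeavesNear hX hX' hY.1 hYdeg n m N
  obtain ⟨M', hM'⟩ := exists_mapsLeavesNear hY hY' hX.1 hXdeg m n N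
  obtain ⟨ρ, hρ⟩ : ∃ ρ, N * (2 * (b M * (2 * M + 1)) + 4 * (M + 2 * N)) + N = ρ := ⟨_, rfl⟩
  refine ⟨b M * (2 * M + 1) + (b' ρ * (2 * (N * ρ + N) + (M + 2 * N)) + 2 * (M + 2 * N)),
    fun q p hq hp hpq => ?_⟩
  obtain ⟨α, hα⟩ := hM q hq
  obtain ⟨α', hα'⟩ := hM' p hp
  have hdata := hα.leafData hX.1 hY.1 hb hq
    (hα.injective hX.1 hX' hY.1 hb hb' hp hpq hα')
  rw [hρ] at hdata
  -- The arrow is read in the leaf of the zero colouring.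
  refine ⟨fun z => (α z.1, (q (0, z.2)).2), ⟨α, fun x => (q (0, x)).2, fun _ _ => rfl⟩, ?_⟩
  rintro ⟨c, x⟩
  exact ((connected hY.1).dist_triangle (v := (α c, (q (c, x)).2))).trans
    (add_le_add (hα.dist_le hY.1 hb c x)
      ((dist_moving_le hY.1 (α c) _ _).trans (hdata.dist_le hY.1 hn hb' c x)))

end LeafPreserving

/-! ### Quasi-isometries: constants, perturbation, quasi-inverses -/

section QuasiIsometry

variable {V W : Type*} {G : SimpleGraph V} {H : SimpleGraph W} {A B : ℝ} {f : V → W}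

theorem IsQuasiIsometryWith.le_of_image (h : IsQuasiIsometryWith G H A B f) (x y : V) :
    (G.dist x y : ℝ) ≤ A * H.dist (f x) (f y) + A * B := by
  have h1 := mul_le_mul_of_nonneg_left (h.lower x y) h.pos.le
  rw [mul_sub, ← mul_assoc, mul_one_div_cancel h.pos.ne', one_mul] at h1
  linarith

theorem IsQuasiIsometryWith.isQIEmbedding (h : IsQuasiIsometryWith G H A B f) {N : ℕ}
    (hN : A + B + A * B ≤ N) : IsQIEmbedding N G H f := by
  have hA := h.pos
  have hB := h.nonneg
  have hAB := mul_nonneg hA.le hB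
  refine fun x y => ⟨?_, ?_⟩
  · have h1 := h.upper x y
    have h2 : A * (G.dist x y : ℝ) ≤ N * G.dist x y := by gcongr; linarith
    have : (H.dist (f x) (f y) : ℝ) ≤ N * G.dist x y + N := by linarith
    exact_mod_cast this
  · have h1 := le_of_image h x y
    have h2 : A * (H.dist (f x) (f y) : ℝ) ≤ N * H.dist (f x) (f y) := by gcongr; linarith
    have : (G.dist x y : ℝ) ≤ N * H.dist (f x) (f y) + N := by linarith
    exact_mod_cast this

theorem cast_dist_triangle (hG : G.Connected) (x y z : V) :
    (G.dist x z : ℝ) ≤ G.dist x y + G.dist y z := by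
  exact_mod_cast hG.dist_triangle (u := x) (v := y) (w := z)

theorem IsQuasiIsometryWith.of_areAtDistLE (hH : H.Connected) (h : IsQuasiIsometryWith G H A B f)
    {Q : ℝ} (hQ : 0 ≤ Q) {f' : V → W} (hf' : AreAtDistLE H Q f f') :
    IsQuasiIsometryWith G H A (B + 2 * Q) f' where
  pos := h.pos
  nonneg := by linarith [h.nonneg]
  lower x y := by
    have h1 := cast_dist_triangle hH (f x) (f' x) (f y)
    have h2 := cast_dist_triangle hH (f' x) (f' y) (f y)
    have h3 := hf' y
    rw [H.dist_comm] at h3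
    linarith [h.lower x y, hf' x]
  upper x y := by
    have h1 := cast_dist_triangle hH (f' x) (f x) (f' y)
    have h2 := cast_dist_triangle hH (f x) (f y) (f' y)
    have h3 := hf' x
    rw [H.dist_comm] at h3
    linarith [h.upper x y, hf' y]
  coarselySurjective z := by
    obtain ⟨x, hx⟩ := h.coarselySurjective z
    exact ⟨x, by linarith [cast_dist_triangle hH z (f x) (f' x), hf' x]⟩

/-- Choose coarse preimages. The upper bound has error `3 * (A * B)`; the lower one has error `3 *
B`, divided by `A`. -/
theorem IsQuasiIsometryWith.exists_quasiInverse (hH : H.Connected)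
    (h : IsQuasiIsometryWith G H A B f) :
    ∃ g : W → V, IsQuasiIsometryWith H G A (3 * (A * B) + 3 * B / A) g ∧
      AreAtDistLE G (3 * (A * B)) (g ∘ f) id ∧ AreAtDistLE H B (f ∘ g) id := by
  have hA := h.pos
  have hAB := mul_nonneg hA.le h.nonneg
  have hBA := div_nonneg (mul_nonneg zero_le_three h.nonneg) hA.le
  choose g hg using h.coarselySurjective
  have hg' (z : W) : (H.dist (f (g z)) z : ℝ) ≤ B := by rw [H.dist_comm]; exact hg z
  have hgf (x : V) : (G.dist (g (f x)) x : ℝ) ≤ 3 * (A * B) := by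
    have h1 := le_of_image h (g (f x)) x
    have h2 := mul_le_mul_of_nonneg_left (hg' (f x)) hA.le
    linarith
  refine ⟨g, ⟨hA, by linarith, fun x y => ?_, fun x y => ?_, fun x => ⟨f x, ?_⟩⟩, hgf, hg'⟩
  · have h1 := cast_dist_triangle hH x (f (g x)) y
    have h2 := cast_dist_triangle hH (f (g x)) (f (g y)) y
    have h3 : (H.dist x y : ℝ) ≤ A * G.dist (g x) (g y) + 3 * B := by
      linarith [h.upper (g x) (g y), hg x, hg' y]
    have h4 := mul_le_mul_of_nonneg_left h3 (one_div_pos.2 hA).le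
    have h5 : 1 / A * (A * (G.dist (g x) (g y) : ℝ) + 3 * B) =
        G.dist (g x) (g y) + 3 * B / A := by
      field_simp
    linarith
  · have h1 := le_of_image h (g x) (g y)
    have h2 := cast_dist_triangle hH (f (g x)) x (f (g y))
    have h3 := cast_dist_triangle hH x y (f (g y))
    have h4 : (H.dist (f (g x)) (f (g y)) : ℝ) ≤ H.dist x y + 2 * B := by
      linarith [hg' x, hg y]
    have h5 := mul_le_mul_of_nonneg_left h4 hA.le
    linarith
  · rw [G.dist_comm]
    linarith [hgf x]

end QuasiIsometry

end Lamplighter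

/-! ### Proof of the theorem -/

open Lamplighter in
theorem mainTheorem3 {V W : Type*} (n m : ℕ) (hn : 2 ≤ n) (hm : 2 ≤ m)
    (X : SimpleGraph V) (Y : SimpleGraph W)
    (hX : IsCoarselyOneConnected X) (hX' : IsUniformlyOneEnded X) (hXdeg : HasBoundedDegree X)
    (hY : IsCoarselyOneConnected Y) (hY' : IsUniformlyOneEnded Y) (hYdeg : HasBoundedDegree Y) :
    ∀ A B : ℝ, 0 < A → 0 ≤ B → ∃ Q : ℝ, 0 ≤ Q ∧
      ∀ q : (V →₀ ZMod n) × V → (W →₀ ZMod m) × W,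
        IsQuasiIsometryWith (lamplighterGraph n X) (lamplighterGraph m Y) A B q →
        ∃ q' : (V →₀ ZMod n) × V → (W →₀ ZMod m) × W,
          IsAptolicQuasiIsometry n m X Y q' ∧ AreAtDistLE (lamplighterGraph m Y) Q q q' := by
  intro A B hA hB
  have hLX := connected (n := n) hX.1
  have hLY := connected (n := m) hY.1
  have hAB := mul_nonneg hA.le hB
  obtain ⟨B', hB'⟩ : ∃ B', 3 * (A * B) + 3 * B / A = B' := ⟨_, rfl⟩
  have hBA := div_nonneg (mul_nonneg zero_le_three hB) hA.le
  have hAB' : 0 ≤ A * B' := mul_nonneg hA.le (by linarith)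
  -- One integer serving for `q`, its quasi-inverse `p` and both compositions; it depends only on
  -- `A` and `B`, hence so does `Q` once the graphs are fixed.
  obtain ⟨N, hN⟩ := exists_nat_ge (A + B + 3 * (A * B) + (B' + A * B'))
  obtain ⟨Q, hQ⟩ := exists_aptolicForm_near (m := m) hn hX hX' hXdeg hY hY' hYdeg N
  obtain ⟨Q', hQ'⟩ := exists_aptolicForm_near (m := n) hm hY hY' hYdeg hX hX' hXdeg N
  refine ⟨Q, Q.cast_nonneg, fun q hq => ?_⟩
  obtain ⟨p, hp, hpq, hqp⟩ := IsQuasiIsometryWith.exists_quasiInverse hLY hq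
  rw [hB'] at hp
  have hqN := IsQuasiIsometryWith.isQIEmbedding hq (N := N) (by linarith)
  have hpN := IsQuasiIsometryWith.isQIEmbedding hp (N := N) (by linarith)
  obtain ⟨q', hq'form, hqq'⟩ := hQ q p hqN hpN fun x => by
    have : ((lamplighterGraph n X).dist (p (q x)) x : ℝ) ≤ N := (hpq x).trans (by linarith)
    exact_mod_cast this
  obtain ⟨p', hp'form, hpp'⟩ := hQ' p q hpN hqN fun z => by
    have : ((lamplighterGraph m Y).dist (q (p z)) z : ℝ) ≤ N := (hqp z).trans (by linarith)
    exact_mod_cast this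
  have hqq'R : AreAtDistLE (lamplighterGraph m Y) Q q q' := fun x => Nat.cast_le.2 (hqq' x)
  have hpp'R : AreAtDistLE (lamplighterGraph n X) Q' p p' := fun x => Nat.cast_le.2 (hpp' x)
  have hq'QI := IsQuasiIsometryWith.of_areAtDistLE hLY hq Q.cast_nonneg hqq'R
  have hp'QI := IsQuasiIsometryWith.of_areAtDistLE hLX hp Q'.cast_nonneg hpp'R
  refine ⟨q', ⟨⟨_, _, hq'QI⟩, hq'form, p', ⟨⟨_, _, hp'QI⟩, ?_⟩, hp'form⟩, hqq'R⟩
  -- The sum of the errors `Q' + (A * Q + B') + 3 * (A * B)` for `p' ∘ q'` and `Q + (A * Q' + B) +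
  -- B` for `q' ∘ p'`.
  obtain ⟨K, hK⟩ : ∃ K : ℝ, A * Q + B' + Q' + 3 * (A * B) + A * Q' + B + Q + B = K := ⟨_, rfl⟩
  have hAQ : 0 ≤ A * Q := mul_nonneg hA.le Q.cast_nonneg
  have hAQ' : 0 ≤ A * Q' := mul_nonneg hA.le Q'.cast_nonneg
  have hQ0 : (0 : ℝ) ≤ Q := Q.cast_nonneg
  have hQ0' : (0 : ℝ) ≤ Q' := Q'.cast_nonneg
  refine ⟨K, fun x => ?_, fun z => ?_⟩
  · have h1 := hpp'R (q' x)
    have h2 := hp.upper (q' x) (q x)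
    have h3 := hqq'R x
    rw [SimpleGraph.dist_comm] at h1 h3
    have h4 := mul_le_mul_of_nonneg_left h3 hA.le
    have h5 := hpq x
    have t1 := cast_dist_triangle hLX (p' (q' x)) (p (q' x)) x
    have t2 := cast_dist_triangle hLX (p (q' x)) (p (q x)) x
    simp only [Function.comp_apply, id_eq] at h5 ⊢
    linarith
  · have h1 := hqq'R (p' z)
    have h2 := hq.upper (p' z) (p z)
    have h3 := hpp'R z
    rw [SimpleGraph.dist_comm] at h1 h3
    have h4 := mul_le_mul_of_nonneg_left h3 hA.le
    have h5 := hqp z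
    have t1 := cast_dist_triangle hLY (q' (p' z)) (q (p' z)) z
    have t2 := cast_dist_triangle hLY (q (p' z)) (q (p z)) z
    simp only [Function.comp_apply, id_eq] at h5 ⊢
    linarith
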